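/- Let $(a_i)_{i\ge 1}$ and $(s_i)_{i\ge 1}$ be two mutually independent sequences of i.i.d. random variables. For $n\ge 1$ put $$X_n=\Big(\sum_{i=1}^n a_i,\ \sum_{i=1}^n s_i\Big),\qquad M_n=\max_{1\le j\le n}\Big\{\sum_{i=1}^{j}a_i+\sum_{i=j+1}^{n+1}s_i\Big\},\qquad m_n=\min_{1\le j\le n}\Big\{\sum_{i=2}^{j}s_i+\sum_{i=j+1}^{n}a_i\Big\}$$ (empty sums are $0$), and for $c\ge 0$ let $E_c$ be the event $\big\{c+\sum_{i=1}^{k}a_i\ \ge\ \sum_{i=1}^{k+1}s_i\ \text{ for all } k\ge 0\big\}$. Then the conditional law of the process $(X_n)_{n\ge 1}$ given the non-collision event $E_0$ is the unconditional law of the process $(M_n,m_n)_{n\ge 1}$, in the following sense. (1) Exponential case. Let the $a_i$ be exponential with parameter $\lambda$ and the $s_i$ exponential with parameter $\mu$, where $0<\lambda<\mu$. Then $P(E_\varepsilon)>0$ for every $\varepsilon>0$ and, as $\varepsilon\downarrow 0$, the conditional law of $(X_n)_{n\ge1}$ given $E_\varepsilon$ converges weakly (on $(\mathbb R^2)^{\{1,2,\dots\}}$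 with the product topology) to the law of $(M_n,m_n)_{n\ge1}$. (The event $E_0$ itself is null, since for $k=0$ it requires $s_1\le 0$.) (2) Geometric case on $\{0,1,2,\dots\}$. Let $P(a_i=k)=(1-p)^{k}p$ and $P(s_i=k)=(1-q)^{k}q$ for $k\ge 0$, where $0<p<q<1$. Then $P(E_0)>0$, and the conditional law of $(X_n)_{n\ge1}$ given $E_0$ equals the law of $(M_n,m_n)_{n\ge1}$. (3) Geometric case on $\{1,2,3,\dots\}$. Let $P(a_i=k)=(1-p)^{k-1}p$ and $P(s_i=k)=(1-q)^{k-1}q$ for $k\ge 1$, where $0<p<q<1$. Since $E_0$ is then empty, it is replaced by $E_1$ (that is, the condition of (2) is imposed on the variables $a_i-1$, $s_i-1$): $P(E_1)>0$, and the conditional law of $\big(\sum_{i=1}^n a_i+1,\ \sum_{i=1}^n s_i\big)_{n\ge1}$ given $E_1$ equals the law of $(M_n,\ m_n+1)_{n\ge1}$. -/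

import Mathlib

open MeasureTheory ProbabilityTheory Filter Topology
open scoped BoundedContinuousFunction

/-- `a 1, a 2, …` and `s 1, s 2, …` are two mutually independent sequences of i.i.d. random
variables, with laws `νa` and `νs` respectively. The values at index `0` play no role. -/
structure IsIIDPair {Ω M : Type*} [MeasurableSpace Ω] [MeasurableSpace M]
    (a s : ℕ → Ω → M) (νa νs : Measure M) (P : Measure Ω) : Prop where
  law_left : ∀ i : ℕ, 1 ≤ i → HasLaw (a i) νa P
  law_right : ∀ i : ℕ, 1 ≤ i → HasLaw (s i) νs P
  indep : iIndepFun (Sum.elim (fun i : ℕ+ => a i) (fun i : ℕ+ => s i)) P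

section Paths

variable {M : Type*} [AddCommMonoid M] [LinearOrder M]

/-- The pair of partial sums `(∑_{i ≤ n} x_i, ∑_{i ≤ n} y_i)`, `n ≥ 1`, as a path. -/
def walkPair (x y : ℕ → M) (n : ℕ+) : M × M :=
  (∑ i ∈ Finset.Icc 1 (n : ℕ), x i, ∑ i ∈ Finset.Icc 1 (n : ℕ), y i)

/-- `max_{1 ≤ j ≤ n} (∑_{i=1}^{j} x_i + ∑_{i=j+1}^{n+1} y_i)`. -/
def maxPath (x y : ℕ → M) (n : ℕ+) : M :=
  (Finset.Icc 1 (n : ℕ)).sup' ⟨1, Finset.mem_Icc.2 ⟨le_rfl, n.2⟩⟩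
    (fun j => ∑ i ∈ Finset.Icc 1 j, x i + ∑ i ∈ Finset.Icc (j + 1) ((n : ℕ) + 1), y i)

/-- `min_{1 ≤ j ≤ n} (∑_{i=2}^{j} y_i + ∑_{i=j+1}^{n} x_i)`; empty sums are zero. -/
def minPath (x y : ℕ → M) (n : ℕ+) : M :=
  (Finset.Icc 1 (n : ℕ)).inf' ⟨1, Finset.mem_Icc.2 ⟨le_rfl, n.2⟩⟩
    (fun j => ∑ i ∈ Finset.Icc 2 j, y i + ∑ i ∈ Finset.Icc (j + 1) (n : ℕ), x i)

/-- The event that `c + ∑_{i ≤ k} a_i ≥ ∑_{i ≤ k+1} s_i` for all `k ≥ 0`: never colliding, when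
the first walk is given a head start `c`. -/
def neverCollide {Ω : Type*} (a s : ℕ → Ω → M) (c : M) : Set Ω :=
  {ω | ∀ k : ℕ, ∑ i ∈ Finset.Icc 1 (k + 1), s i ω ≤ c + ∑ i ∈ Finset.Icc 1 k, a i ω}

end Paths

/-! The proof is a form of Burke's theorem for the single-server queue. The map `serve` on triples
(state, interarrival time, service time) is an involution that fixes $y-a$, $y+s$ and $a+s$. It
preserves $\pi\otimes\nu_a\otimes\nu_s$ for a suitable law $\pi$ of the state: exponential of
parameter $\mu-\lambda$, or geometric of parameter $r$ with $1-q=(1-r)(1-p)$.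

Run $N$ steps backwards from a final state $y$, with the increments of the two walks as outputs. The
initial state is then at most $c$ exactly when the walks obey the constraint of $E_c$ up to time $N$
and a terminal inequality involving $y$ holds (`backward_fst_le_iff`). Since the mean of $a$ exceeds
that of $s$, the terminal inequality holds for all large $N$ almost surely. By invariance the same
expectation can be computed forwards, and $N\to\infty$ gives
`IsStationaryQueue.integral_staysAhead`: the walk restricted to $E_c$ has the law of the output of
the queue whose initial state has law $\pi$ restricted to $(-\infty,c]$. In particular
$P(E_c)=\pi(-\infty,c]$.

At $c=0$, or as $c\downarrow0$, the queue starts from state $0$, and its accumulated outputs are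
$(M_n,m_n)$ (`pairSums_queueOutput_zero`). -/

/-! ### The queue as a deterministic reversible map. -/

/-- One step of the single-server queue with state `y`, interarrival time `a` and service time `s`:
the new state, the interdeparture time and the dual service time. -/
noncomputable def serve (z : ℝ × ℝ × ℝ) : ℝ × ℝ × ℝ :=
  (z.1 - min z.1 z.2.1 + z.2.2, z.2.1 - min z.1 z.2.1 + z.2.2, min z.1 z.2.1)

lemma serve_involutive : Function.Involutive serve := by
  rintro ⟨y, a, s⟩
  have h : min (y - min y a + s) (a - min y a + s) = s := by
    rcases le_total y a with h | h <;> simp [h]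
  simp [serve, h]

@[fun_prop]
lemma continuous_serve : Continuous serve := by
  unfold serve
  fun_prop

/-- Apply `serve` to the state and to the `i`-th entry of a sequence. -/
noncomputable def serveAt (i : ℕ) (z : ℝ × (ℕ → ℝ × ℝ)) : ℝ × (ℕ → ℝ × ℝ) :=
  ((serve (z.1, z.2 i)).1, Function.update z.2 i (serve (z.1, z.2 i)).2)

lemma serveAt_involutive (i : ℕ) : Function.Involutive (serveAt i) := by
  rintro ⟨y, x⟩
  have h := serve_involutive (y, x i)
  simp [serveAt, h]

/-- The states of the queue started from `y` and fed with `x`. -/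
noncomputable def queue (y : ℝ) (x : ℕ → ℝ × ℝ) : ℕ → ℝ
  | 0 => y
  | n + 1 => (serve (queue y x n, x n)).1

/-- The interdeparture times and dual service times of the queue started from `y`. -/
noncomputable def queueOutput (y : ℝ) (x : ℕ → ℝ × ℝ) (i : ℕ) : ℝ × ℝ :=
  (serve (queue y x i, x i)).2

/-- The first `N` steps of the queue. -/
noncomputable def forward (N : ℕ) (z : ℝ × (ℕ → ℝ × ℝ)) : ℝ × (ℕ → ℝ × ℝ) :=
  (queue z.1 z.2 N, fun i => if i < N then queueOutput z.1 z.2 i else z.2 i)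

/-- The inverse of `forward N`: the steps `N - 1, …, 0`, in this order. -/
noncomputable def backward : ℕ → ℝ × (ℕ → ℝ × ℝ) → ℝ × (ℕ → ℝ × ℝ)
  | 0 => id
  | N + 1 => backward N ∘ serveAt N

lemma forward_succ (N : ℕ) (z : ℝ × (ℕ → ℝ × ℝ)) :
    forward (N + 1) z = serveAt N (forward N z) := by
  ext1
  · simp [forward, serveAt, queue]
  · funext i
    rcases lt_trichotomy i N with h | rfl | h
    · simp [forward, serveAt, h, h.ne, h.le]
    · simp [forward, serveAt, queueOutput]
    · simp [forward, serveAt, h.ne', h.not_gt, h.not_ge]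

lemma forward_backward (N : ℕ) (z : ℝ × (ℕ → ℝ × ℝ)) : forward N (backward N z) = z := by
  induction N generalizing z with
  | zero => simp [forward, backward, queue]
  | succ N ih => rw [forward_succ, backward, Function.comp_apply, ih, serveAt_involutive]

/-- Each backward step is the Lindley recursion $y\mapsto\max(y-a,0)+s$. Bounding a maximum means
bounding both arguments: the argument $0$ yields the constraint at time $N$, and the argument $y-a$
carries the terminal inequality to $N+1$. -/
lemma backward_fst_le_iff (N : ℕ) (z : ℝ × (ℕ → ℝ × ℝ)) (c : ℝ) :
    (backward N z).1 ≤ c ↔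
      (∀ k < N, ∑ i ∈ Finset.range (k + 1), (z.2 i).2 ≤ c + ∑ i ∈ Finset.range k, (z.2 i).1) ∧
        z.1 + ∑ i ∈ Finset.range N, (z.2 i).2 ≤ c + ∑ i ∈ Finset.range N, (z.2 i).1 := by
  induction N generalizing z with
  | zero => simp [backward]
  | succ N ih =>
    have hs (g : ℝ × ℝ → ℝ) (k : ℕ) (hk : k ≤ N) :
        ∑ i ∈ Finset.range k, g ((serveAt N z).2 i) = ∑ i ∈ Finset.range k, g (z.2 i) := by
      refine Finset.sum_congr rfl fun i hi => ?_
      have : i ≠ N := ((Finset.mem_range.1 hi).trans_le hk).ne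
      simp [serveAt, this]
    rw [backward, Function.comp_apply, ih, hs _ N le_rfl, hs _ N le_rfl]
    have h1 : (∀ k < N, ∑ i ∈ Finset.range (k + 1), ((serveAt N z).2 i).2 ≤
          c + ∑ i ∈ Finset.range k, ((serveAt N z).2 i).1) ↔
        ∀ k < N, ∑ i ∈ Finset.range (k + 1), (z.2 i).2 ≤
          c + ∑ i ∈ Finset.range k, (z.2 i).1 := by
      refine forall₂_congr fun k hk => ?_
      rw [hs _ (k + 1) hk, hs _ k hk.le]
    rw [h1, Nat.forall_lt_succ_right, and_assoc]
    refine and_congr_right fun _ => ?_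
    simp only [serveAt, serve, Finset.sum_range_succ]
    rcases le_total z.1 (z.2 N).1 with h | h
    · rw [min_eq_left h]
      constructor
      · intro h'; constructor <;> linarith
      · rintro ⟨h', -⟩; linarith
    · rw [min_eq_right h]
      constructor
      · intro h'; constructor <;> linarith
      · rintro ⟨-, h'⟩; linarith

@[fun_prop]
lemma continuous_queue (n : ℕ) :
    Continuous fun z : ℝ × (ℕ → ℝ × ℝ) => queue z.1 z.2 n := by
  induction n with
  | zero => exact continuous_fst
  | succ n ih => simp only [queue]; fun_prop

@[fun_prop]
lemma continuous_queueOutput :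
    Continuous fun z : ℝ × (ℕ → ℝ × ℝ) => queueOutput z.1 z.2 := by
  unfold queueOutput
  fun_prop

@[fun_prop]
lemma continuous_forward (N : ℕ) : Continuous (forward N) := by
  unfold forward
  refine (continuous_queue N).prodMk (continuous_pi fun i => ?_)
  split_ifs <;> fun_prop

lemma tendsto_forward_snd (z : ℝ × (ℕ → ℝ × ℝ)) :
    Tendsto (fun N => (forward N z).2) atTop (𝓝 (queueOutput z.1 z.2)) := by
  rw [tendsto_pi_nhds]
  intro i
  refine tendsto_const_nhds.congr' ?_
  filter_upwards [eventually_gt_atTop i] with N hN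
  simp [forward, hN]

/-! ### Partial sums of the output and the extremal paths. -/

/-- The pairs of partial sums of a sequence of pairs. -/
def pairSums (x : ℕ → ℝ × ℝ) (n : ℕ+) : ℝ × ℝ :=
  (∑ i ∈ Finset.range n, (x i).1, ∑ i ∈ Finset.range n, (x i).2)

@[fun_prop]
lemma continuous_pairSums : Continuous pairSums := by
  unfold pairSums
  fun_prop

lemma sum_range_eq_sum_Icc {M : Type*} [AddCommMonoid M] (f : ℕ → M) (n : ℕ) :
    ∑ i ∈ Finset.range n, f (i + 1) = ∑ i ∈ Finset.Icc 1 n, f i := by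
  rw [Finset.range_eq_Ico, Finset.sum_Ico_add', ← Finset.Ico_add_one_right_eq_Icc, zero_add]

lemma walkPair_eq_pairSums (a s : ℕ → ℝ) :
    walkPair a s = pairSums fun i => (a (i + 1), s (i + 1)) := by
  funext n
  simp [walkPair, pairSums, sum_range_eq_sum_Icc]

lemma maxPath_le_iff {M : Type*} [AddCommMonoid M] [LinearOrder M] (x y : ℕ → M) (n : ℕ+) (c : M) :
    maxPath x y n ≤ c ↔ ∀ j ∈ Finset.Icc 1 (n : ℕ),
      ∑ i ∈ Finset.Icc 1 j, x i + ∑ i ∈ Finset.Icc (j + 1) ((n : ℕ) + 1), y i ≤ c :=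
  Finset.sup'_le_iff _ _

lemma le_minPath_iff {M : Type*} [AddCommMonoid M] [LinearOrder M] (x y : ℕ → M) (n : ℕ+) (c : M) :
    c ≤ minPath x y n ↔ ∀ j ∈ Finset.Icc 1 (n : ℕ),
      c ≤ ∑ i ∈ Finset.Icc 2 j, y i + ∑ i ∈ Finset.Icc (j + 1) (n : ℕ), x i :=
  Finset.le_inf'_iff _ _

lemma maxPath_add_one (a s : ℕ → ℝ) (n : ℕ+) :
    maxPath a s (n + 1) =
      max (∑ i ∈ Finset.Icc 1 ((n : ℕ) + 1), a i) (maxPath a s n) + s (n + 2) := by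
  refine eq_of_forall_ge_iff fun c => ?_
  have hI : Finset.Icc 1 ((n : ℕ) + 1) = insert ((n : ℕ) + 1) (Finset.Icc 1 (n : ℕ)) :=
    (Finset.insert_Icc_right_eq_Icc_add_one (by lia)).symm
  rw [← le_sub_iff_add_le, max_le_iff, maxPath_le_iff, maxPath_le_iff,
    PNat.add_coe, PNat.one_coe, hI, Finset.forall_mem_insert, ← hI]
  refine and_congr ?_ (forall₂_congr fun j hj => ?_)
  · rw [Finset.Icc_self, Finset.sum_singleton, le_sub_iff_add_le]
  · rw [Finset.sum_Icc_succ_top (b := (n : ℕ) + 1) (by grind)]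
    constructor <;> intro h <;> linarith

lemma minPath_add_one (a s : ℕ → ℝ) (n : ℕ+) :
    minPath a s (n + 1) =
      min (∑ i ∈ Finset.Icc 2 ((n : ℕ) + 1), s i) (minPath a s n + a (n + 1)) := by
  refine eq_of_forall_le_iff fun c => ?_
  have hI : Finset.Icc 1 ((n : ℕ) + 1) = insert ((n : ℕ) + 1) (Finset.Icc 1 (n : ℕ)) :=
    (Finset.insert_Icc_right_eq_Icc_add_one (by lia)).symm
  rw [le_min_iff, ← sub_le_iff_le_add, le_minPath_iff, le_minPath_iff,
    PNat.add_coe, PNat.one_coe, hI, Finset.forall_mem_insert]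
  refine and_congr ?_ (forall₂_congr fun j hj => ?_)
  · rw [Finset.Icc_eq_empty (a := (n : ℕ) + 1 + 1) (by lia), Finset.sum_empty, add_zero]
  · rw [Finset.sum_Icc_succ_top (b := (n : ℕ)) (by grind)]
    constructor <;> intro h <;> linarith

/-- Both sides satisfy the same recursion in $n$. The services are shifted by one because $s_1$
enters neither $M_n$ nor $m_n$. Nonnegativity serves only at $n=1$, where $\min(0,a_1)$ must be the
empty sum $0$. -/
lemma pairSums_queueOutput_zero (a s : ℕ → ℝ) (ha : ∀ i, 1 ≤ i → 0 ≤ a i) :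
    pairSums (queueOutput 0 fun i => (a (i + 1), s (i + 2))) =
      fun n => (maxPath a s n, minPath a s n) := by
  set x : ℕ → ℝ × ℝ := fun i => (a (i + 1), s (i + 2)) with hx
  -- Conservation of $y-a$: the state is total departures minus total arrivals.
  have hq (n : ℕ) : queue 0 x n =
      ∑ i ∈ Finset.range n, (queueOutput 0 x i).1 - ∑ i ∈ Finset.Icc 1 n, a i := by
    induction n with
    | zero => simp [queue]
    | succ n ih =>
      rw [Finset.sum_range_succ, Finset.sum_Icc_succ_top (by lia)]
      simp only [queue, queueOutput, serve, hx] at ih ⊢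
      linarith
  -- Conservation of $y+s$: the state is total service minus total dual service.
  have ht (n : ℕ) : queue 0 x n =
      ∑ i ∈ Finset.Icc 2 (n + 1), s i - ∑ i ∈ Finset.range n, (queueOutput 0 x i).2 := by
    induction n with
    | zero => simp [queue]
    | succ n ih =>
      rw [Finset.sum_range_succ, Finset.sum_Icc_succ_top (by lia)]
      simp only [queue, queueOutput, serve, hx] at ih ⊢
      linarith
  funext n
  induction n with
  | one =>
    have h1 := ha 1 le_rfl
    simp [pairSums, maxPath, minPath, queueOutput, queue, serve, hx, h1]
  | succ n ih =>
    rw [Prod.ext_iff] at ih ⊢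
    simp only [pairSums] at ih ⊢
    obtain ⟨ih1, ih2⟩ := ih
    rw [maxPath_add_one, minPath_add_one, ← ih1, ← ih2, PNat.add_coe, PNat.one_coe,
      Finset.sum_range_succ, Finset.sum_range_succ, Finset.sum_Icc_succ_top (by lia)]
    have e1 := hq n
    have e2 := ht n
    have o1 : (queueOutput 0 x n).1 =
      a (n + 1) - min (queue 0 x n) (a (n + 1)) + s (n + 2) := rfl
    have o2 : (queueOutput 0 x n).2 = min (queue 0 x n) (a (n + 1)) := rfl
    rcases le_total (queue 0 x n) (a (n + 1)) with h | h
    · rw [o1, o2, min_eq_left h, max_eq_left (by linarith), min_eq_left (by linarith)]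
      constructor <;> linarith
    · rw [o1, o2, min_eq_right h, max_eq_right (by linarith), min_eq_right (by linarith)]
      constructor <;> linarith

/-! ### Invariance of the stationary law and reversal of time. -/

lemma measurePreserving_update_infinitePi {ι E : Type*} [DecidableEq ι] [MeasurableSpace E]
    (ν : Measure E) [IsProbabilityMeasure ν] (i : ι) :
    MeasurePreserving (fun z : E × (ι → E) => Function.update z.2 i z.1)
      (ν.prod (Measure.infinitePi fun _ => ν)) (Measure.infinitePi fun _ => ν) := by
  have hm : Measurable (fun z : E × (ι → E) => Function.update z.2 i z.1) := by
    refine measurable_pi_iff.2 fun j => ?_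
    by_cases h : j = i
    · subst h; simpa using measurable_fst
    · simpa [h, Function.comp_def] using (measurable_pi_apply j).comp measurable_snd
  refine ⟨hm, Measure.eq_infinitePi _ fun s t ht => ?_⟩
  rw [Measure.map_apply hm (.pi s.countable_toSet fun j _ => ht j)]
  by_cases hi : i ∈ s
  · have : (fun z : E × (ι → E) => Function.update z.2 i z.1) ⁻¹' (Set.pi s t) =
        t i ×ˢ Set.pi (s.erase i : Finset ι) t := by
      ext z
      simp only [Set.mem_preimage, Set.mem_pi, Set.mem_prod, Finset.mem_coe, Finset.mem_erase]
      constructor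
      · exact fun h => ⟨by simpa using h i hi, fun j hj => by simpa [hj.1] using h j hj.2⟩
      · rintro ⟨h1, h2⟩ j hj
        by_cases h : j = i
        · subst h; simpa using h1
        · simpa [h] using h2 j ⟨h, hj⟩
    rw [this, Measure.prod_prod, Measure.infinitePi_pi _ (fun j _ => ht j),
      Finset.mul_prod_erase s (fun j => ν (t j)) hi]
  · have : (fun z : E × (ι → E) => Function.update z.2 i z.1) ⁻¹' (Set.pi s t) =
        Set.univ ×ˢ Set.pi s t := by
      ext z
      simp only [Set.mem_preimage, Set.mem_pi, Set.mem_prod, Finset.mem_coe, Set.mem_univ,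
        true_and]
      refine forall₂_congr fun j hj => ?_
      rw [Function.update_of_ne (ne_of_mem_of_not_mem (Finset.mem_coe.1 hj) hi)]
    rw [this, Measure.prod_prod, Measure.infinitePi_pi _ (fun j _ => ht j), measure_univ, one_mul]

/-- The law `π` of the state is stationary for the queue with interarrival law `νa` and service
law `νs`, whose departure process then satisfies Burke's theorem; the queue is stable. -/
structure IsStationaryQueue (π νa νs : Measure ℝ) : Prop where
  prob_state : IsProbabilityMeasure π
  prob_left : IsProbabilityMeasure νa
  prob_right : IsProbabilityMeasure νs
  preserving : MeasurePreserving serve (π.prod (νa.prod νs)) (π.prod (νa.prod νs))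
  state_nonneg : ∀ᵐ y ∂π, 0 ≤ y
  left_nonneg : ∀ᵐ y ∂νa, 0 ≤ y
  integrable_left : Integrable id νa
  integrable_right : Integrable id νs
  mean_lt : ∫ x, x ∂νs < ∫ x, x ∂νa

section Queue

variable {π νa νs : Measure ℝ}

/-- Resampling coordinate $i$ from an independent copy presents the product law as an image of
$(\pi\otimes\nu_a\otimes\nu_s)\otimes\kappa$. There `serveAt i` lifts to `serve` on the first
factor, whose invariance is assumed. -/
lemma IsStationaryQueue.measurePreserving_serveAt (h : IsStationaryQueue π νa νs) (i : ℕ) :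
    MeasurePreserving (serveAt i) (π.prod (Measure.infinitePi fun _ => νa.prod νs))
      (π.prod (Measure.infinitePi fun _ => νa.prod νs)) := by
  have := h.prob_state
  have := h.prob_left
  have := h.prob_right
  set κ := Measure.infinitePi fun _ : ℕ => νa.prod νs with hκ
  have hU : MeasurePreserving (fun z : (ℝ × ℝ × ℝ) × (ℕ → ℝ × ℝ) =>
      (z.1.1, Function.update z.2 i z.1.2)) ((π.prod (νa.prod νs)).prod κ) (π.prod κ) :=
    ((MeasurePreserving.id π).prod (measurePreserving_update_infinitePi (νa.prod νs) i)).comp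
      (measurePreserving_prodAssoc π (νa.prod νs) κ)
  have hS : MeasurePreserving (Prod.map serve id) ((π.prod (νa.prod νs)).prod κ)
      ((π.prod (νa.prod νs)).prod κ) := h.preserving.prod (.id κ)
  have hm : Measurable (serveAt i) := by
    unfold serveAt
    refine Measurable.prodMk (by fun_prop) (measurable_pi_iff.2 fun j => ?_)
    by_cases hj : j = i
    · subst hj; simp only [Function.update_self]; fun_prop
    · simp only [ne_eq, hj, not_false_eq_true, Function.update_of_ne]; fun_prop
  refine ⟨hm, ?_⟩
  conv_lhs => rw [← hU.map_eq, Measure.map_map hm hU.measurable]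
  rw [← (hU.comp hS).map_eq]
  congr 1
  funext z
  simp [serveAt]

lemma IsStationaryQueue.measurePreserving_backward (h : IsStationaryQueue π νa νs) (N : ℕ) :
    MeasurePreserving (backward N) (π.prod (Measure.infinitePi fun _ => νa.prod νs))
      (π.prod (Measure.infinitePi fun _ => νa.prod νs)) := by
  induction N with
  | zero => exact .id _
  | succ N ih => exact ih.comp (h.measurePreserving_serveAt N)

/-- Strong law of large numbers with positive mean increment. -/
lemma IsStationaryQueue.ae_tendsto_drift (h : IsStationaryQueue π νa νs) :
    ∀ᵐ x ∂(Measure.infinitePi fun _ : ℕ => νa.prod νs),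
      Tendsto (fun N : ℕ => ∑ i ∈ Finset.range N, ((x i).1 - (x i).2)) atTop atTop := by
  have := h.prob_left
  have := h.prob_right
  set κ := Measure.infinitePi fun _ : ℕ => νa.prod νs with hκ
  have h1 : Integrable (fun p : ℝ × ℝ => p.1) (νa.prod νs) := h.integrable_left.comp_fst νs
  have h2 : Integrable (fun p : ℝ × ℝ => p.2) (νa.prod νs) := h.integrable_right.comp_snd νa
  have hd : Integrable (fun p : ℝ × ℝ => p.1 - p.2) (νa.prod νs) := h1.sub h2
  have hev (i : ℕ) : MeasurePreserving (Function.eval i) κ (νa.prod νs) :=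
    measurePreserving_eval_infinitePi _ i
  have hlaw (i : ℕ) : IdentDistrib (fun x : ℕ → ℝ × ℝ => (x i).1 - (x i).2)
      (fun x => (x 0).1 - (x 0).2) κ κ := by
    have : IdentDistrib (Function.eval i) (Function.eval 0) κ κ :=
      ⟨(hev i).aemeasurable, (hev 0).aemeasurable, (hev i).map_eq.trans (hev 0).map_eq.symm⟩
    exact this.comp (u := fun p : ℝ × ℝ => p.1 - p.2) (by fun_prop)
  have hind : iIndepFun (fun (i : ℕ) (x : ℕ → ℝ × ℝ) => (x i).1 - (x i).2) κ :=
    iIndepFun_infinitePi (X := fun _ (p : ℝ × ℝ) => p.1 - p.2) (by fun_prop)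
  have hmean : 0 < ∫ x, ((x 0).1 - (x 0).2) ∂κ := by
    have e := (hev 0).map_eq
    have : ∫ x, ((x 0).1 - (x 0).2) ∂κ = ∫ p : ℝ × ℝ, (p.1 - p.2) ∂(νa.prod νs) := by
      rw [← e, integral_map (hev 0).aemeasurable (by fun_prop)]
    rw [this, integral_sub h1 h2, integral_fun_fst (fun x : ℝ => x),
      integral_fun_snd (fun x : ℝ => x)]
    simpa using h.mean_lt
  filter_upwards [strong_law_ae_real _ ((hev 0).integrable_comp_of_integrable hd)
    (fun i j hij => hind.indepFun hij) hlaw] with x hx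
  have := hx.pos_mul_atTop hmean tendsto_natCast_atTop_atTop
  refine this.congr' ?_
  filter_upwards [eventually_gt_atTop 0] with N hN
  have : (N : ℝ) ≠ 0 := by positivity
  field_simp

/-- The increments of two walks, the first of which has a head start `c` and stays ahead. -/
def staysAhead (c : ℝ) : Set (ℕ → ℝ × ℝ) :=
  {x | ∀ k : ℕ, ∑ i ∈ Finset.range (k + 1), (x i).2 ≤ c + ∑ i ∈ Finset.range k, (x i).1}

lemma isClosed_staysAhead (c : ℝ) : IsClosed (staysAhead c) := by
  rw [staysAhead, Set.ofPred_forall]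
  exact isClosed_iInter fun k => isClosed_le (by fun_prop) (by fun_prop)

/-- The core identity. `L N` tests the increments as outputs, on the event that the reconstructed
initial state is at most $c$; `R N` is the same quantity read forwards from the initial state. Their
integrals agree by invariance, and both pass to the limit by domination. -/
lemma IsStationaryQueue.integral_staysAhead (h : IsStationaryQueue π νa νs) (c : ℝ)
    (g : (ℕ → ℝ × ℝ) →ᵇ ℝ) :
    ∫ x in staysAhead c, g x ∂(Measure.infinitePi fun _ : ℕ => νa.prod νs) =
      ∫ y in Set.Iic c, ∫ x, g (queueOutput y x)
        ∂(Measure.infinitePi fun _ : ℕ => νa.prod νs) ∂π := by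
  have := h.prob_state
  have := h.prob_left
  have := h.prob_right
  set κ := Measure.infinitePi fun _ : ℕ => νa.prod νs with hκ
  set L : ℕ → ℝ × (ℕ → ℝ × ℝ) → ℝ :=
    fun N => {z | (backward N z).1 ≤ c}.indicator fun z => g z.2 with hL
  set R : ℕ → ℝ × (ℕ → ℝ × ℝ) → ℝ :=
    fun N => {z | z.1 ≤ c}.indicator fun z => g (forward N z).2 with hR
  have hset : MeasurableSet {z : ℝ × (ℕ → ℝ × ℝ) | z.1 ≤ c} :=
    measurableSet_le measurable_fst measurable_const
  have hRm (N : ℕ) : Measurable (R N) :=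
    (g.continuous.measurable.comp
      (measurable_snd.comp (continuous_forward N).measurable)).indicator hset
  have hLR (N : ℕ) : L N = R N ∘ backward N := by
    funext z
    simp [hL, hR, Set.indicator_apply, forward_backward]
  have hLm (N : ℕ) : Measurable (L N) := by
    rw [hLR]; exact (hRm N).comp (h.measurePreserving_backward N).measurable
  have hint (N : ℕ) : ∫ z, L N z ∂(π.prod κ) = ∫ z, R N z ∂(π.prod κ) := by
    have hp := h.measurePreserving_backward N
    conv_rhs => rw [← hp.map_eq]
    rw [integral_map hp.aemeasurable (hRm N).aestronglyMeasurable, hLR]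
    rfl
  have hlimR : Tendsto (fun N => ∫ z, R N z ∂(π.prod κ)) atTop
      (𝓝 (∫ z in {z | z.1 ≤ c}, g (queueOutput z.1 z.2) ∂(π.prod κ))) := by
    rw [← integral_indicator hset]
    refine tendsto_integral_of_dominated_convergence (fun _ => ‖g‖)
      (fun N => (hRm N).aestronglyMeasurable) (integrable_const _)
      (fun N => ae_of_all _ fun z => ?_) (ae_of_all _ fun z => ?_)
    · exact (norm_indicator_le_norm_self _ _).trans (g.norm_coe_le_norm _)
    · by_cases hz : z.1 ≤ c
      · simpa [hR, hz, Function.comp_def] using (g.continuous.tendsto _).comp (tendsto_forward_snd z)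
      · simp [hR, hz]
  have hlimL : Tendsto (fun N => ∫ z, L N z ∂(π.prod κ)) atTop
      (𝓝 (∫ z, (staysAhead c).indicator g z.2 ∂(π.prod κ))) := by
    refine tendsto_integral_of_dominated_convergence (fun _ => ‖g‖)
      (fun N => (hLm N).aestronglyMeasurable) (integrable_const _)
      (fun N => ae_of_all _ fun z => ?_) ?_
    · exact (norm_indicator_le_norm_self _ _).trans (g.norm_coe_le_norm _)
    · have hdrift : ∀ᵐ z ∂(π.prod κ),
          Tendsto (fun N : ℕ => ∑ i ∈ Finset.range N, ((z.2 i).1 - (z.2 i).2)) atTop atTop :=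
        Measure.quasiMeasurePreserving_snd.ae h.ae_tendsto_drift
      filter_upwards [hdrift] with z hz
      refine tendsto_const_nhds.congr' ?_
      by_cases hE : z.2 ∈ staysAhead c
      -- On the event, the drift eventually secures the terminal inequality; off it, a violation at
      -- some $k$ persists for every $N>k$.
      · filter_upwards [hz.eventually_ge_atTop (z.1 - c)] with N hN
        rw [Finset.sum_sub_distrib] at hN
        have : (backward N z).1 ≤ c :=
          (backward_fst_le_iff N z c).2 ⟨fun k _ => hE k, by linarith⟩
        simp [hL, hE, this]
      · have hE' := hE
        simp only [staysAhead, Set.mem_ofPred_eq, not_forall] at hE'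
        obtain ⟨k, hk⟩ := hE'
        filter_upwards [eventually_gt_atTop k] with N hN
        have : ¬ (backward N z).1 ≤ c := fun hc =>
          hk (((backward_fst_le_iff N z c).1 hc).1 k hN)
        simp [hL, hE, this]
  have hlim := tendsto_nhds_unique hlimL (by simpa only [hint] using hlimR)
  rw [integral_fun_snd, probReal_univ, one_smul,
    integral_indicator (isClosed_staysAhead c).measurableSet] at hlim
  have hprod : {z : ℝ × (ℕ → ℝ × ℝ) | z.1 ≤ c} = Set.Iic c ×ˢ Set.univ := by ext; simp
  rw [hlim, hprod, setIntegral_prod, Measure.restrict_univ]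
  refine Integrable.integrableOn (Integrable.of_bound (C := ‖g‖) ?_ ?_)
  · exact (g.continuous.comp continuous_queueOutput).aestronglyMeasurable
  · exact ae_of_all _ fun z => g.norm_coe_le_norm _

lemma IsStationaryQueue.measure_staysAhead (h : IsStationaryQueue π νa νs) (c : ℝ) :
    (Measure.infinitePi fun _ : ℕ => νa.prod νs) (staysAhead c) = π (Set.Iic c) := by
  have := h.prob_state
  have := h.prob_left
  have := h.prob_right
  have := h.integral_staysAhead c (BoundedContinuousFunction.const _ 1)
  simp only [BoundedContinuousFunction.const_apply, integral_const, probReal_univ, smul_eq_mul,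
    mul_one, measureReal_restrict_apply_univ] at this
  exact (measureReal_eq_measureReal_iff).1 this

end Queue

/-! ### Laws of the i.i.d. input. -/

section Law

variable {Ω M : Type*} [MeasurableSpace Ω] [MeasurableSpace M] {P : Measure Ω}

lemma IsIIDPair.comp {N : Type*} [MeasurableSpace N] {a s : ℕ → Ω → M} {νa νs : Measure M}
    (h : IsIIDPair a s νa νs P) {g : M → N} (hg : Measurable g) :
    IsIIDPair (fun i ω => g (a i ω)) (fun i ω => g (s i ω)) (νa.map g) (νs.map g) P where
  law_left i hi := HasLaw.fun_comp ⟨hg.aemeasurable, rfl⟩ (h.law_left i hi)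
  law_right i hi := HasLaw.fun_comp ⟨hg.aemeasurable, rfl⟩ (h.law_right i hi)
  indep := by
    convert h.indep.comp (fun _ => g) (fun _ => hg) using 1
    funext i
    cases i <;> rfl

/-- The shift is $k=0$ for the conditioned walks and $k=1$ for the input of the queue that builds
$(M_n,m_n)$; the law is the same. -/
lemma IsIIDPair.hasLaw_pairs {a s : ℕ → Ω → M} {νa νs : Measure M}
    [IsProbabilityMeasure νa] [IsProbabilityMeasure νs]
    (h : IsIIDPair a s νa νs P) (k : ℕ) :
    HasLaw (fun ω i => (a (i + 1) ω, s (i + 1 + k) ω))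
      (Measure.infinitePi fun _ : ℕ => νa.prod νs) P := by
  let e : ℕ × Bool → ℕ+ ⊕ ℕ+ := fun j =>
    if j.2 then .inr ⟨j.1 + 1 + k, by lia⟩ else .inl ⟨j.1 + 1, by lia⟩
  have he : e.Injective := by
    rintro ⟨i, _ | _⟩ ⟨j, _ | _⟩ hij
    · have := congrArg PNat.val (Sum.inl.inj hij)
      simp_all
    · simp [e] at hij
    · simp [e] at hij
    · have := congrArg PNat.val (Sum.inr.inj hij)
      simp_all
  let μ : ℕ → Bool → Measure M := fun _ b => if b then νs else νa
  have hμ (i : ℕ) (b : Bool) : IsProbabilityMeasure (μ i b) := by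
    cases b <;> simp only [μ] <;> infer_instance
  have hlaw (j : ℕ × Bool) :
      HasLaw (Sum.elim (fun i : ℕ+ => a i) (fun i : ℕ+ => s i) (e j)) (μ j.1 j.2) P := by
    rcases j with ⟨i, _ | _⟩
    · exact h.law_left (i + 1) (by lia)
    · exact h.law_right (i + 1 + k) (by lia)
  have h1 := (h.indep.precomp he).hasLaw_infinitePi hlaw
    (aemeasurable_pi_iff.2 fun j => (hlaw j).aemeasurable)
  have h2 : HasLaw (MeasurableEquiv.curry ℕ Bool M)
      (Measure.infinitePi fun i => Measure.infinitePi fun b => μ i b)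
      (Measure.infinitePi fun p : ℕ × Bool => μ p.1 p.2) :=
    ⟨(MeasurableEquiv.measurable _).aemeasurable, Measure.infinitePi_map_curry μ⟩
  have h3 : HasLaw (fun (x : ℕ → Bool → M) i => (x i false, x i true))
      (Measure.infinitePi fun _ : ℕ => νa.prod νs)
      (Measure.infinitePi fun i => Measure.infinitePi fun b => μ i b) := by
    refine ⟨by fun_prop, ?_⟩
    rw [Measure.infinitePi_map_pi (f := fun _ (x : Bool → M) => (x false, x true)) _
      (fun _ => by fun_prop)]
    congr 1
    funext i
    exact Measure.infinitePi_map_eval_prod (P := μ i) (by decide)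
  exact (h3.comp h2).comp h1

end Law

/-! ### From the queue identity to conditional laws. -/

section Conditioning

variable {Ω : Type*} [MeasurableSpace Ω] {P : Measure Ω} {π νa νs : Measure ℝ}
  {a s : ℕ → Ω → ℝ}

omit [MeasurableSpace Ω] in
lemma neverCollide_eq_preimage (a s : ℕ → Ω → ℝ) (c : ℝ) :
    neverCollide a s c = (fun ω i => (a (i + 1) ω, s (i + 1) ω)) ⁻¹' staysAhead c := by
  ext ω
  simp only [neverCollide, staysAhead, Set.mem_preimage, Set.mem_ofPred_eq]
  refine forall_congr' fun k => ?_
  rw [sum_range_eq_sum_Icc (fun i => s i ω), sum_range_eq_sum_Icc (fun i => a i ω)]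

lemma IsStationaryQueue.measure_neverCollide (h : IsStationaryQueue π νa νs)
    (hP : IsIIDPair a s νa νs P) (c : ℝ) : P (neverCollide a s c) = π (Set.Iic c) := by
  have := h.prob_left
  have := h.prob_right
  rw [neverCollide_eq_preimage, ← h.measure_staysAhead, ← (hP.hasLaw_pairs 0).map_eq,
    Measure.map_apply_of_aemeasurable (hP.hasLaw_pairs 0).aemeasurable
      (isClosed_staysAhead c).measurableSet]

/-- The expectation of a functional of the output of the queue, given its initial state. -/
noncomputable def meanOutput (νa νs : Measure ℝ) (f : (ℕ+ → ℝ × ℝ) →ᵇ ℝ) (y : ℝ) : ℝ :=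
  ∫ x, f (pairSums (queueOutput y x)) ∂(Measure.infinitePi fun _ : ℕ => νa.prod νs)

lemma IsStationaryQueue.continuous_meanOutput (h : IsStationaryQueue π νa νs)
    (f : (ℕ+ → ℝ × ℝ) →ᵇ ℝ) : Continuous (meanOutput νa νs f) := by
  have := h.prob_left
  have := h.prob_right
  have hc : Continuous fun z : ℝ × (ℕ → ℝ × ℝ) => f (pairSums (queueOutput z.1 z.2)) := by
    fun_prop
  refine continuous_of_dominated (bound := fun _ => ‖f‖) (fun y => ?_)
    (fun y => ae_of_all _ fun x => f.norm_coe_le_norm _) (integrable_const _)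
    (ae_of_all _ fun x => ?_)
  · exact (hc.comp (Continuous.prodMk_right y)).aestronglyMeasurable
  · exact hc.comp (Continuous.prodMk_left x)

/-- The normalising constants agree because $P(E_c)=\pi(-\infty,c]$. -/
lemma IsStationaryQueue.integral_cond (h : IsStationaryQueue π νa νs)
    (hP : IsIIDPair a s νa νs P) (c : ℝ) (f : (ℕ+ → ℝ × ℝ) →ᵇ ℝ) :
    ∫ ω, f (walkPair (fun i => a i ω) (fun i => s i ω)) ∂(cond P (neverCollide a s c)) =
      ⨍ y in Set.Iic c, meanOutput νa νs f y ∂π := by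
  have := h.prob_left
  have := h.prob_right
  have hlaw := hP.hasLaw_pairs 0
  rw [ProbabilityTheory.cond, integral_smul_measure, h.measure_neverCollide hP, setAverage_eq,
    Measure.real, ENNReal.toReal_inv]
  congr 1
  rw [neverCollide_eq_preimage]
  have := h.integral_staysAhead c (f.compContinuous ⟨pairSums, continuous_pairSums⟩)
  simp only [BoundedContinuousFunction.compContinuous_apply, ContinuousMap.coe_mk] at this
  unfold meanOutput
  rw [← this, ← hlaw.map_eq, setIntegral_map (isClosed_staysAhead c).measurableSet _
    hlaw.aemeasurable]
  · simp only [walkPair_eq_pairSums]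
  · exact (f.continuous.comp continuous_pairSums).aestronglyMeasurable

lemma continuous_pairSums_queueOutput_zero :
    Continuous fun x : ℕ → ℝ × ℝ => pairSums (queueOutput 0 x) := by
  have : Continuous fun z : ℝ × (ℕ → ℝ × ℝ) => pairSums (queueOutput z.1 z.2) := by
    fun_prop
  exact this.comp (Continuous.prodMk_right 0)

lemma IsStationaryQueue.ae_pairSums_queueOutput (h : IsStationaryQueue π νa νs)
    (hP : IsIIDPair a s νa νs P) :
    ∀ᵐ ω ∂P, pairSums (queueOutput 0 fun i => (a (i + 1) ω, s (i + 1 + 1) ω)) =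
      fun n => (maxPath (fun i => a i ω) (fun i => s i ω) n,
        minPath (fun i => a i ω) (fun i => s i ω) n) := by
  have hnn : ∀ᵐ ω ∂P, ∀ i, 1 ≤ i → 0 ≤ a i ω := by
    refine ae_all_iff.2 fun i => ?_
    by_cases hi : 1 ≤ i
    · have hl := hP.law_left i hi
      have := h.left_nonneg
      rw [← hl.map_eq] at this
      filter_upwards [ae_of_ae_map hl.aemeasurable this] with ω hω _ using hω
    · exact ae_of_all _ fun ω h' => absurd h' hi
  filter_upwards [hnn] with ω hω
  exact pairSums_queueOutput_zero (fun i => a i ω) (fun i => s i ω) hω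

lemma IsStationaryQueue.meanOutput_zero (h : IsStationaryQueue π νa νs)
    (hP : IsIIDPair a s νa νs P) (f : (ℕ+ → ℝ × ℝ) →ᵇ ℝ) :
    meanOutput νa νs f 0 = ∫ ω, f (fun n => (maxPath (fun i => a i ω) (fun i => s i ω) n,
      minPath (fun i => a i ω) (fun i => s i ω) n)) ∂P := by
  have := h.prob_left
  have := h.prob_right
  have hlaw := hP.hasLaw_pairs 1
  have hc : Continuous fun x => f (pairSums (queueOutput 0 x)) :=
    f.continuous.comp continuous_pairSums_queueOutput_zero
  rw [meanOutput, ← hlaw.map_eq, integral_map hlaw.aemeasurable hc.aestronglyMeasurable]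
  refine integral_congr_ae ?_
  filter_upwards [h.ae_pairSums_queueOutput hP] with ω hω
  rw [hω]

lemma IsStationaryQueue.aemeasurable_extremalPath (h : IsStationaryQueue π νa νs)
    (hP : IsIIDPair a s νa νs P) :
    AEMeasurable (fun ω (n : ℕ+) => (maxPath (fun i => a i ω) (fun i => s i ω) n,
      minPath (fun i => a i ω) (fun i => s i ω) n)) P := by
  have := h.prob_left
  have := h.prob_right
  exact (continuous_pairSums_queueOutput_zero.measurable.comp_aemeasurable
    (hP.hasLaw_pairs 1).aemeasurable).congr (h.ae_pairSums_queueOutput hP)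

lemma IsStationaryQueue.aemeasurable_walkPair (h : IsStationaryQueue π νa νs)
    (hP : IsIIDPair a s νa νs P) :
    AEMeasurable (fun ω => walkPair (fun i => a i ω) (fun i => s i ω)) P := by
  have := h.prob_left
  have := h.prob_right
  simp only [walkPair_eq_pairSums]
  exact continuous_pairSums.measurable.comp_aemeasurable (hP.hasLaw_pairs 0).aemeasurable

lemma IsStationaryQueue.tendsto_integral_cond (h : IsStationaryQueue π νa νs)
    (hP : IsIIDPair a s νa νs P) (hpos : ∀ ε : ℝ, 0 < ε → π (Set.Iic ε) ≠ 0)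
    (f : (ℕ+ → ℝ × ℝ) →ᵇ ℝ) :
    Tendsto (fun ε : ℝ => ∫ ω, f (walkPair (fun i => a i ω) (fun i => s i ω))
        ∂(cond P (neverCollide a s ε))) (𝓝[>] 0)
      (𝓝 (∫ ω, f (fun n => (maxPath (fun i => a i ω) (fun i => s i ω) n,
        minPath (fun i => a i ω) (fun i => s i ω) n)) ∂P)) := by
  have := h.prob_state
  have := h.prob_left
  have := h.prob_right
  simp only [h.integral_cond hP]
  rw [← h.meanOutput_zero hP, Metric.nhds_basis_closedBall.tendsto_right_iff]
  intro δ hδ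
  obtain ⟨r, hr, hball⟩ := Metric.continuousAt_iff'.1
    (h.continuous_meanOutput f).continuousAt δ hδ |> Metric.eventually_nhds_iff.1
  filter_upwards [Ioo_mem_nhdsGT hr] with ε hε
  -- As $\pi$ lives on $[0,\infty)$, the average is over $[0,\varepsilon]$, where the continuous
  -- function `meanOutput` is within $\delta$ of its value at $0$.
  refine (convex_closedBall _ _).set_average_mem Metric.isClosed_closedBall (hpos ε hε.1)
    (measure_ne_top _ _) ?_ ?_
  · filter_upwards [ae_restrict_mem measurableSet_Iic, ae_restrict_of_ae h.state_nonneg]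
      with y hy hy0
    refine (hball ?_).le
    rw [Real.dist_eq, sub_zero, abs_of_nonneg hy0]
    exact lt_of_le_of_lt hy hε.2
  · refine Integrable.integrableOn (Integrable.of_bound (C := ‖f‖)
      (h.continuous_meanOutput f).aestronglyMeasurable (ae_of_all _ fun y => ?_))
    refine (norm_integral_le_of_norm_le_const (ae_of_all _ fun x => f.norm_coe_le_norm _)).trans ?_
    simp

lemma IsStationaryQueue.map_cond [IsProbabilityMeasure P] (h : IsStationaryQueue π νa νs)
    (hP : IsIIDPair a s νa νs P) (hpos : π (Set.Iic 0) ≠ 0) :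
    (cond P (neverCollide a s 0)).map (fun ω => walkPair (fun i => a i ω) (fun i => s i ω)) =
      P.map (fun ω (n : ℕ+) => (maxPath (fun i => a i ω) (fun i => s i ω) n,
        minPath (fun i => a i ω) (fun i => s i ω) n)) := by
  have := h.prob_state
  have hw : AEMeasurable (fun ω => walkPair (fun i => a i ω) (fun i => s i ω))
      (cond P (neverCollide a s 0)) :=
    (h.aemeasurable_walkPair hP).mono_ac cond_absolutelyContinuous
  have hm := h.aemeasurable_extremalPath hP
  have := cond_isProbabilityMeasure (μ := P) (s := neverCollide a s 0)
    (by rwa [h.measure_neverCollide hP])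
  refine ext_of_forall_integral_eq_of_IsFiniteMeasure fun f => ?_
  rw [integral_map hw f.continuous.aestronglyMeasurable,
    integral_map hm f.continuous.aestronglyMeasurable, h.integral_cond hP, ← h.meanOutput_zero hP]
  -- The state is nonnegative, so $\pi$ restricted to $(-\infty,0]$ is an atom at $0$.
  have : ∀ᵐ y ∂π.restrict (Set.Iic 0), meanOutput νa νs f y = meanOutput νa νs f 0 := by
    filter_upwards [ae_restrict_mem measurableSet_Iic, ae_restrict_of_ae h.state_nonneg]
      with y hy hy0
    rw [le_antisymm hy hy0]
  rw [average_congr this]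
  exact setAverage_const hpos (measure_ne_top _ _) _

end Conditioning

/-! ### Stationarity for exponential laws. -/

section Exponential

/-- In the coordinates $(d,a,s)$ with $d=y-a$, `serve` fixes $d$, swaps $a$ and $s$, and translates
them by $\mp\min(d,0)$. Shears, swaps and translations preserve Lebesgue measure. -/
lemma measurePreserving_serve_volume :
    MeasurePreserving serve (volume : Measure (ℝ × ℝ × ℝ)) volume := by
  have shear (g : ℝ × ℝ → ℝ) (hg : Measurable g) :
      MeasurePreserving (fun z : ℝ × ℝ × ℝ => (z.1 + g z.2, z.2)) volume volume := by
    have h : MeasurePreserving (fun z : (ℝ × ℝ) × ℝ => (z.1, z.2 + g z.1))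
        ((volume : Measure (ℝ × ℝ)).prod volume) ((volume : Measure (ℝ × ℝ)).prod volume) :=
      (MeasurePreserving.id _).skew_product (g := fun w x => x + g w) (by fun_prop)
        (ae_of_all _ fun w => map_add_right_eq_self _ _)
    exact Measure.measurePreserving_swap.comp (h.comp Measure.measurePreserving_swap)
  have exch : MeasurePreserving
      (fun z : ℝ × ℝ × ℝ => (z.1, (z.2.2 - min z.1 0, z.2.1 + min z.1 0))) volume volume := by
    refine (MeasurePreserving.id (volume : Measure ℝ)).skew_product
      (g := fun d (w : ℝ × ℝ) => (w.2 - min d 0, w.1 + min d 0)) (by fun_prop)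
      (ae_of_all _ fun d => ?_)
    have h : MeasurePreserving (fun w : ℝ × ℝ => (w.1 - min d 0, w.2 + min d 0))
        (volume.prod volume) (volume.prod volume) :=
      (measurePreserving_sub_right volume _).prod (measurePreserving_add_right volume _)
    exact (h.comp Measure.measurePreserving_swap).map_eq
  convert (shear (fun w => w.1) (by fun_prop)).comp
    (exch.comp (shear (fun w => -w.1) (by fun_prop))) using 1
  funext ⟨y, a, s⟩
  rcases le_total y a with h | h
  · have h' : y + -a ≤ 0 := by linarith
    simp [serve, h, h']
    ring
  · have h' : 0 ≤ y + -a := by linarith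
    simp [serve, h, h']
    ring

lemma MeasureTheory.MeasurePreserving.withDensity_of_comp_eq {α : Type*} [MeasurableSpace α]
    {μ : Measure α} {f : α → α} (hf : MeasurePreserving f μ μ) {ρ : α → ENNReal}
    (hρ : Measurable ρ) (hinv : ∀ x, ρ (f x) = ρ x) :
    MeasurePreserving f (μ.withDensity ρ) (μ.withDensity ρ) := by
  refine ⟨hf.measurable, Measure.ext fun t ht => ?_⟩
  rw [Measure.map_apply hf.measurable ht, withDensity_apply _ (hf.measurable ht),
    withDensity_apply _ ht, ← hf.setLIntegral_comp_preimage ht hρ]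
  simp only [hinv]

lemma measurable_exponentialPDF (r : ℝ) : Measurable (exponentialPDF r) :=
  (measurable_exponentialPDFReal r).ennreal_ofReal

lemma expMeasure_eq_withDensity (r : ℝ) : expMeasure r = volume.withDensity (exponentialPDF r) :=
  rfl

/-- The exponent $(\mu-\lambda)y+\lambda a+\mu s$ equals $(\mu-\lambda)(y+s)+\lambda(a+s)$, a
function of conserved quantities, and the involution maps the nonnegative octant onto itself. -/
lemma exponentialPDF_mul_serve {lam mu : ℝ} (hlam : 0 < lam) (hmu : lam < mu) (z : ℝ × ℝ × ℝ) :
    exponentialPDF (mu - lam) (serve z).1 *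
        (exponentialPDF lam (serve z).2.1 * exponentialPDF mu (serve z).2.2) =
      exponentialPDF (mu - lam) z.1 * (exponentialPDF lam z.2.1 * exponentialPDF mu z.2.2) := by
  have key (w : ℝ × ℝ × ℝ) :
      exponentialPDF (mu - lam) w.1 * (exponentialPDF lam w.2.1 * exponentialPDF mu w.2.2) =
      if 0 ≤ w.1 ∧ 0 ≤ w.2.1 ∧ 0 ≤ w.2.2 then ENNReal.ofReal ((mu - lam) * (lam * mu) *
        Real.exp (-((mu - lam) * (w.1 + w.2.2) + lam * (w.2.1 + w.2.2)))) else 0 := by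
    by_cases h1 : 0 ≤ w.1 <;> by_cases h2 : 0 ≤ w.2.1 <;> by_cases h3 : 0 ≤ w.2.2 <;>
      simp only [exponentialPDF_eq, h1, h2, h3, if_true, if_false, and_true, and_false,
        ENNReal.ofReal_zero, zero_mul, mul_zero]
    have : 0 < mu - lam := by linarith
    have : 0 < mu := by linarith
    rw [← ENNReal.ofReal_mul (by positivity), ← ENNReal.ofReal_mul (by positivity)]
    congr 1
    rw [show -((mu - lam) * (w.1 + w.2.2) + lam * (w.2.1 + w.2.2)) =
      -((mu - lam) * w.1) + (-(lam * w.2.1) + -(mu * w.2.2)) by ring, Real.exp_add, Real.exp_add]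
    ring
  have hnn (w : ℝ × ℝ × ℝ) (hw : 0 ≤ w.1 ∧ 0 ≤ w.2.1 ∧ 0 ≤ w.2.2) :
      0 ≤ (serve w).1 ∧ 0 ≤ (serve w).2.1 ∧ 0 ≤ (serve w).2.2 := by
    obtain ⟨h1, h2, h3⟩ := hw
    have := min_le_left w.1 w.2.1
    have := min_le_right w.1 w.2.1
    refine ⟨?_, ?_, le_min h1 h2⟩ <;> simp only [serve] <;> linarith
  have hiff : (0 ≤ (serve z).1 ∧ 0 ≤ (serve z).2.1 ∧ 0 ≤ (serve z).2.2) ↔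
      (0 ≤ z.1 ∧ 0 ≤ z.2.1 ∧ 0 ≤ z.2.2) :=
    ⟨fun h => by simpa only [serve_involutive z] using hnn _ h, hnn z⟩
  rw [key, key, if_congr hiff rfl rfl]
  simp only [serve]
  ring_nf

lemma integral_expMeasure {r : ℝ} (hr : 0 < r) : ∫ x, x ∂(expMeasure r) = 1 / r := by
  rw [expMeasure_eq_withDensity, integral_withDensity_eq_integral_toReal_smul
    (measurable_exponentialPDF r) (ae_of_all _ fun x => ENNReal.ofReal_lt_top)]
  have h1 : ∀ x, (exponentialPDF r x).toReal • x =
      (Set.Ioi (0 : ℝ)).indicator (fun t => r * (t ^ ((2 : ℝ) - 1) * Real.exp (-(r * t)))) x := by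
    intro x
    rw [exponentialPDF_eq]
    rcases lt_trichotomy x 0 with h | rfl | h
    · simp [h.not_ge, h.le]
    · simp
    · rw [if_pos h.le, ENNReal.toReal_ofReal (by positivity), Set.indicator_of_mem (Set.mem_Ioi.2 h)]
      norm_num
      ring
  simp only [h1]
  rw [integral_indicator measurableSet_Ioi, integral_const_mul,
    Real.integral_rpow_mul_exp_neg_mul_Ioi two_pos hr]
  norm_num [Real.Gamma_two]
  field_simp

lemma integrable_id_expMeasure {r : ℝ} (hr : 0 < r) : Integrable id (expMeasure r) := by
  by_contra h
  -- The integral of a non-integrable function is $0$ by convention, which contradicts the mean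
  -- $1/r$.
  have := integral_undef h
  simp only [id, integral_expMeasure hr] at this
  exact (one_div_pos.2 hr).ne' this

lemma expMeasure_ae_nonneg (r : ℝ) : ∀ᵐ x ∂(expMeasure r), 0 ≤ x := by
  rw [expMeasure_eq_withDensity, ae_withDensity_iff (measurable_exponentialPDF r)]
  refine ae_of_all _ fun x hx => ?_
  by_contra h
  exact hx (exponentialPDF_of_neg (not_le.1 h))

lemma expMeasure_Iic_ne_zero {r ε : ℝ} (hr : 0 < r) (hε : 0 < ε) :
    expMeasure r (Set.Iic ε) ≠ 0 := by
  have := isProbabilityMeasure_expMeasure hr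
  intro h0
  have h1 := cdf_expMeasure_eq hr ε
  rw [cdf_eq_real, Measure.real, h0, if_pos hε.le, ENNReal.toReal_zero] at h1
  have : Real.exp (-(r * ε)) < 1 := Real.exp_lt_one_iff.2 (by nlinarith)
  linarith

lemma isStationaryQueue_expMeasure {lam mu : ℝ} (hlam : 0 < lam) (hmu : lam < mu) :
    IsStationaryQueue (expMeasure (mu - lam)) (expMeasure lam) (expMeasure mu) := by
  have hmu0 := hlam.trans hmu
  have p1 := isProbabilityMeasure_expMeasure (sub_pos.2 hmu)
  have p2 := isProbabilityMeasure_expMeasure hlam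
  have p3 := isProbabilityMeasure_expMeasure hmu0
  refine ⟨p1, p2, p3, ?_, expMeasure_ae_nonneg _, expMeasure_ae_nonneg _,
    integrable_id_expMeasure hlam, integrable_id_expMeasure hmu0, ?_⟩
  · have m1 := measurable_exponentialPDF (mu - lam)
    have m2 := measurable_exponentialPDF lam
    have m3 := measurable_exponentialPDF mu
    simp only [expMeasure_eq_withDensity]
    rw [prod_withDensity m2 m3, prod_withDensity m1 (by fun_prop)]
    exact measurePreserving_serve_volume.withDensity_of_comp_eq (by fun_prop)
      (exponentialPDF_mul_serve hlam hmu)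
  · rw [integral_expMeasure hlam, integral_expMeasure hmu0]
    exact one_div_lt_one_div_of_lt hlam hmu

end Exponential

/-! ### Stationarity for geometric laws and transfer to integer-valued paths. -/

section Geometric

/-- The restriction of `serve` to the natural numbers. -/
def serveNat (z : ℕ × ℕ × ℕ) : ℕ × ℕ × ℕ :=
  (z.1 - min z.1 z.2.1 + z.2.2, z.2.1 - min z.1 z.2.1 + z.2.2, min z.1 z.2.1)

lemma serveNat_involutive : Function.Involutive serveNat := by
  rintro ⟨y, a, s⟩
  simp only [serveNat, Prod.mk.injEq]
  lia

/-- The coordinatewise embedding of `ℕ³` into `ℝ³`. -/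
def castTriple : ℕ × ℕ × ℕ → ℝ × ℝ × ℝ :=
  Prod.map Nat.cast (Prod.map Nat.cast Nat.cast)

lemma serve_castTriple (z : ℕ × ℕ × ℕ) : serve (castTriple z) = castTriple (serveNat z) := by
  simp [serve, serveNat, castTriple]

lemma integral_natCast_geometricMeasure {p : unitInterval} (hp : 0 < p) :
    ∫ n, (n : ℝ) ∂(geometricMeasure p) = (1 - p) / p := by
  have hp' : (0 : ℝ) < p := hp
  have h1 : ‖(1 - p : ℝ)‖ < 1 := by
    rw [Real.norm_of_nonneg (by linarith [p.2.2])]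
    linarith
  rw [integral_geometricMeasure hp.ne']
  have := tsum_coe_mul_geometric_of_norm_lt_one h1
  rw [show (fun n : ℕ => ((1 - p : ℝ) ^ n * p) • (n : ℝ)) =
    fun n : ℕ => (p : ℝ) * ((n : ℝ) * (1 - p : ℝ) ^ n) by funext n; simp only [smul_eq_mul]; ring,
    tsum_mul_left, this, sub_sub_cancel]
  field_simp

lemma integrable_natCast_geometricMeasure {p : unitInterval} (hp : 0 < p) :
    Integrable (fun n : ℕ => (n : ℝ)) (geometricMeasure p) := by
  have hp' : (0 : ℝ) < p := hp
  have h1 : ‖(1 - p : ℝ)‖ < 1 := by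
    rw [Real.norm_of_nonneg (by linarith [p.2.2])]
    linarith
  rw [integrable_geometricMeasure_iff hp.ne']
  refine ((hasSum_coe_mul_geometric_of_norm_lt_one h1).summable.mul_left (p : ℝ)).congr
    fun n => ?_
  rw [Real.norm_natCast]
  ring

/-- Since $1-q=(1-r)(1-p)$, the mass of $(y,a,s)$ depends only on $y+s$ and $a+s$, which the
involution conserves. -/
lemma measurePreserving_serveNat {p q r : unitInterval} (hp : 0 < p) (hq : 0 < q) (hr : 0 < r)
    (h : (1 - q : ℝ) = (1 - r) * (1 - p)) :
    MeasurePreserving serveNat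
      ((geometricMeasure r).prod ((geometricMeasure p).prod (geometricMeasure q)))
      ((geometricMeasure r).prod ((geometricMeasure p).prod (geometricMeasure q))) := by
  refine ⟨measurable_of_countable _, Measure.ext_of_singleton fun z => ?_⟩
  have weight (y a s : ℕ) :
      ((geometricMeasure r).prod ((geometricMeasure p).prod (geometricMeasure q))) {(y, a, s)} =
        ENNReal.ofReal (r * p * q * ((1 - r : ℝ) ^ (y + s) * (1 - p : ℝ) ^ (a + s))) := by
    rw [← Set.singleton_prod_singleton, ← Set.singleton_prod_singleton, Measure.prod_prod,
      Measure.prod_prod, geometricMeasure_singleton hp.ne', geometricMeasure_singleton hq.ne',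
      geometricMeasure_singleton hr.ne', ← ENNReal.ofReal_mul (geometricMeasure_nonneg p _),
      ← ENNReal.ofReal_mul (geometricMeasure_nonneg r _), h, mul_pow]
    congr 1
    ring
  have hpre : serveNat ⁻¹' {z} = {serveNat z} := by
    ext w
    exact serveNat_involutive.eq_iff
  obtain ⟨y, a, s⟩ := z
  rw [Measure.map_apply (measurable_of_countable _) (measurableSet_singleton _), hpre, weight]
  simp only [serveNat]
  rw [weight, show y - min y a + s + min y a = y + s by lia,
    show a - min y a + s + min y a = a + s by lia]

lemma exists_isStationaryQueue_geometricMeasure {p q : unitInterval} (hp : 0 < p) (hpq : p < q)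
    (hq : q < 1) :
    ∃ r : unitInterval, 0 < r ∧ IsStationaryQueue ((geometricMeasure r).map Nat.cast)
      ((geometricMeasure p).map Nat.cast) ((geometricMeasure q).map Nat.cast) := by
  have hp' : (0 : ℝ) < p := hp
  have hpq' : (p : ℝ) < q := hpq
  have hq' : (q : ℝ) < 1 := hq
  have hq0 := hp.trans hpq
  have h1p : (0 : ℝ) < 1 - p := by linarith
  -- The solution of $1-q=(1-r)(1-p)$.
  let r : unitInterval := ⟨(q - p) / (1 - p), div_nonneg (by linarith) h1p.le,
    (div_le_one h1p).2 (by linarith)⟩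
  have hrv : (r : ℝ) = (q - p) / (1 - p) := rfl
  have hr : 0 < r := by
    rw [← unitInterval.coe_pos, hrv]
    exact div_pos (by linarith) h1p
  have hm : Measurable (Nat.cast : ℕ → ℝ) := measurable_of_countable _
  have hnn (p : unitInterval) : ∀ᵐ x ∂((geometricMeasure p).map (Nat.cast : ℕ → ℝ)), 0 ≤ x :=
    (ae_map_iff hm.aemeasurable measurableSet_Ici).2 (ae_of_all _ fun n => Nat.cast_nonneg n)
  have hint {p : unitInterval} (hp : 0 < p) :
      Integrable id ((geometricMeasure p).map (Nat.cast : ℕ → ℝ)) :=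
    (integrable_map_measure aestronglyMeasurable_id hm.aemeasurable).2
      (integrable_natCast_geometricMeasure hp)
  have hmean {p : unitInterval} (hp : 0 < p) :
      ∫ x, x ∂((geometricMeasure p).map (Nat.cast : ℕ → ℝ)) = (1 - p) / p := by
    rw [integral_map (f := fun x => x) hm.aemeasurable aestronglyMeasurable_id]
    exact integral_natCast_geometricMeasure hp
  refine ⟨r, hr, Measure.isProbabilityMeasure_map hm.aemeasurable,
    Measure.isProbabilityMeasure_map hm.aemeasurable,
    Measure.isProbabilityMeasure_map hm.aemeasurable, ?_, hnn r, hnn p, hint hp, hint hq0, ?_⟩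
  · have hN := measurePreserving_serveNat (r := r) hp hq0 hr (by rw [hrv]; field_simp; ring)
    have hc : Measurable castTriple := measurable_of_countable _
    rw [Measure.map_prod_map _ _ hm hm, Measure.map_prod_map _ _ hm (hm.prodMap hm)]
    refine ⟨continuous_serve.measurable, ?_⟩
    change Measure.map serve (Measure.map castTriple _) = Measure.map castTriple _
    rw [Measure.map_map continuous_serve.measurable hc]
    conv_rhs => rw [← hN.map_eq, Measure.map_map hc hN.measurable]
    congr 1
    funext z
    exact serve_castTriple z
  · rw [hmean hp, hmean hq0, div_lt_div_iff₀ (by linarith) hp']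
    nlinarith

lemma map_maxPath {M N : Type*} [AddCommMonoid M] [LinearOrder M] [AddCommMonoid N] [LinearOrder N]
    {g : M → N} (hg : ∀ u v, g (max u v) = max (g u) (g v)) {x y : ℕ → M} {x' y' : ℕ → N} {n : ℕ+}
    (h : ∀ j ∈ Finset.Icc 1 (n : ℕ),
      g (∑ i ∈ Finset.Icc 1 j, x i + ∑ i ∈ Finset.Icc (j + 1) ((n : ℕ) + 1), y i) =
        ∑ i ∈ Finset.Icc 1 j, x' i + ∑ i ∈ Finset.Icc (j + 1) ((n : ℕ) + 1), y' i) :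
    g (maxPath x y n) = maxPath x' y' n :=
  (Finset.apply_sup'_eq_sup'_comp _ g hg).trans (Finset.sup'_congr _ rfl h)

lemma map_minPath {M N : Type*} [AddCommMonoid M] [LinearOrder M] [AddCommMonoid N] [LinearOrder N]
    {g : M → N} (hg : ∀ u v, g (min u v) = min (g u) (g v)) {x y : ℕ → M} {x' y' : ℕ → N} {n : ℕ+}
    (h : ∀ j ∈ Finset.Icc 1 (n : ℕ),
      g (∑ i ∈ Finset.Icc 2 j, y i + ∑ i ∈ Finset.Icc (j + 1) (n : ℕ), x i) =
        ∑ i ∈ Finset.Icc 2 j, y' i + ∑ i ∈ Finset.Icc (j + 1) (n : ℕ), x' i) :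
    g (minPath x y n) = minPath x' y' n :=
  (Finset.apply_inf'_eq_inf'_comp _ g hg).trans (Finset.inf'_congr _ rfl h)

lemma natCast_maxPath (x y : ℕ → ℕ) (n : ℕ+) :
    ((maxPath x y n : ℕ) : ℝ) = maxPath (fun i => (x i : ℝ)) (fun i => (y i : ℝ)) n :=
  map_maxPath Nat.cast_max fun j _ => by push_cast; rfl

lemma natCast_minPath (x y : ℕ → ℕ) (n : ℕ+) :
    ((minPath x y n : ℕ) : ℝ) = minPath (fun i => (x i : ℝ)) (fun i => (y i : ℝ)) n :=
  map_minPath Nat.cast_min fun j _ => by push_cast; rfl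

/-- Every competing sum has $j+(n+1-j)=n+1$ terms. -/
lemma maxPath_add_one_add_one (x y : ℕ → ℕ) (n : ℕ+) :
    maxPath (fun i => x i + 1) (fun i => y i + 1) n = maxPath x y n + (n + 1) := by
  refine (map_maxPath (g := fun k => k + ((n : ℕ) + 1)) (fun u v => by lia) fun j hj => ?_).symm
  rw [Finset.mem_Icc] at hj
  simp only [Finset.sum_add_distrib, Finset.sum_const, Nat.card_Icc, smul_eq_mul]
  lia

/-- Every competing sum has $(j-1)+(n-j)=n-1$ terms. -/
lemma minPath_add_one_add_one (x y : ℕ → ℕ) (n : ℕ+) :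
    minPath (fun i => x i + 1) (fun i => y i + 1) n + 1 = minPath x y n + n := by
  have hn := n.pos
  have : minPath x y n + ((n : ℕ) - 1) = minPath (fun i => x i + 1) (fun i => y i + 1) n := by
    refine map_minPath (g := fun k => k + ((n : ℕ) - 1)) (fun u v => by lia) fun j hj => ?_
    rw [Finset.mem_Icc] at hj
    simp only [Finset.sum_add_distrib, Finset.sum_const, Nat.card_Icc, smul_eq_mul]
    lia
  lia

variable {Ω : Type*} [MeasurableSpace Ω] {P : Measure Ω} [IsProbabilityMeasure P]

theorem geometric_nonColliding {p q : unitInterval} {a s : ℕ → Ω → ℕ} (hp : 0 < p) (hpq : p < q)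
    (hq : q < 1) (h : IsIIDPair a s (geometricMeasure p) (geometricMeasure q) P) :
    P (neverCollide a s 0) ≠ 0 ∧
      AEMeasurable (fun ω => walkPair (fun i => a i ω) (fun i => s i ω)) P ∧
      AEMeasurable (fun ω (n : ℕ+) => (maxPath (fun i => a i ω) (fun i => s i ω) n,
        minPath (fun i => a i ω) (fun i => s i ω) n)) P ∧
      (cond P (neverCollide a s 0)).map
          (fun ω => walkPair (fun i => a i ω) (fun i => s i ω)) =
        P.map (fun ω (n : ℕ+) => (maxPath (fun i => a i ω) (fun i => s i ω) n,
          minPath (fun i => a i ω) (fun i => s i ω) n)) := by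
  obtain ⟨r, hr, hQ⟩ := exists_isStationaryQueue_geometricMeasure hp hpq hq
  have hm : Measurable (Nat.cast : ℕ → ℝ) := measurable_of_countable _
  have hR := h.comp hm
  have hset : neverCollide (fun i ω => (a i ω : ℝ)) (fun i ω => (s i ω : ℝ)) 0 =
      neverCollide a s 0 := by
    ext ω
    simp only [neverCollide, Set.mem_ofPred_eq]
    exact_mod_cast Iff.rfl
  have hpos : ((geometricMeasure r).map (Nat.cast : ℕ → ℝ)) (Set.Iic 0) ≠ 0 := by
    rw [Measure.map_apply hm measurableSet_Iic,
      show (Nat.cast : ℕ → ℝ) ⁻¹' Set.Iic 0 = {0} by ext; simp,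
      geometricMeasure_singleton hr.ne']
    simpa using hr
  -- A measurable left inverse of the cast, which carries the real-valued identity of laws back to
  -- integer paths.
  let F : (ℕ+ → ℝ × ℝ) → (ℕ+ → ℕ × ℕ) := fun u n => (⌊(u n).1⌋₊, ⌊(u n).2⌋₊)
  have hF : Measurable F := by
    refine measurable_pi_iff.2 fun n => ?_
    exact (Nat.measurable_floor.comp (by fun_prop)).prodMk (Nat.measurable_floor.comp (by fun_prop))
  have hW : (fun ω => walkPair (fun i => a i ω) (fun i => s i ω)) =
      F ∘ fun ω => walkPair (fun i => (a i ω : ℝ)) (fun i => (s i ω : ℝ)) := by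
    funext ω n
    simp only [walkPair, F, Function.comp_apply, ← Nat.cast_sum, Nat.floor_natCast]
  have hM : (fun ω (n : ℕ+) => (maxPath (fun i => a i ω) (fun i => s i ω) n,
        minPath (fun i => a i ω) (fun i => s i ω) n)) =
      F ∘ fun ω (n : ℕ+) => (maxPath (fun i => (a i ω : ℝ)) (fun i => (s i ω : ℝ)) n,
        minPath (fun i => (a i ω : ℝ)) (fun i => (s i ω : ℝ)) n) := by
    funext ω n
    simp only [F, Function.comp_apply, ← natCast_maxPath, ← natCast_minPath, Nat.floor_natCast]
  have hWm := hQ.aemeasurable_walkPair hR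
  have hMm := hQ.aemeasurable_extremalPath hR
  have hlaw := hQ.map_cond hR hpos
  rw [hset] at hlaw
  refine ⟨by rwa [← hset, hQ.measure_neverCollide hR], ?_, ?_, ?_⟩
  · rw [hW]; exact hF.comp_aemeasurable hWm
  · rw [hM]; exact hF.comp_aemeasurable hMm
  · rw [hW, hM, ← AEMeasurable.map_map_of_aemeasurable hF.aemeasurable hMm,
      ← AEMeasurable.map_map_of_aemeasurable hF.aemeasurable
        (hWm.mono_ac cond_absolutelyContinuous), hlaw]

theorem geometric_succ_nonColliding {p q : unitInterval} {a s : ℕ → Ω → ℕ} (hp : 0 < p)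
    (hpq : p < q) (hq : q < 1)
    (h : IsIIDPair a s ((geometricMeasure p).map (fun k => k + 1))
      ((geometricMeasure q).map (fun k => k + 1)) P) :
    P (neverCollide a s 1) ≠ 0 ∧
      (cond P (neverCollide a s 1)).map
          (fun ω (n : ℕ+) =>
            ((walkPair (fun i => a i ω) (fun i => s i ω) n).1 + 1,
              (walkPair (fun i => a i ω) (fun i => s i ω) n).2)) =
        P.map (fun ω (n : ℕ+) =>
          (maxPath (fun i => a i ω) (fun i => s i ω) n,
            minPath (fun i => a i ω) (fun i => s i ω) n + 1)) := by
  have hm : Measurable fun k : ℕ => k - 1 := measurable_of_countable _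
  have hm1 : Measurable fun k : ℕ => k + 1 := measurable_of_countable _
  -- The variables are almost surely at least $1$, so truncated subtraction of $1$ loses nothing.
  have hpos {X : ℕ → Ω → ℕ} {ν : Measure ℕ}
      (hX : ∀ i, 1 ≤ i → HasLaw (X i) (ν.map (fun k => k + 1)) P) :
      ∀ᵐ ω ∂P, ∀ i, 1 ≤ i → X i ω = (X i ω - 1) + 1 := by
    refine ae_all_iff.2 fun i => ?_
    by_cases hi : 1 ≤ i
    · have hν : ∀ᵐ x ∂(ν.map (fun k => k + 1)), 1 ≤ x :=
        (ae_map_iff hm1.aemeasurable measurableSet_Ici).2 (ae_of_all _ fun n => by lia)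
      rw [← (hX i hi).map_eq] at hν
      filter_upwards [ae_of_ae_map (hX i hi).aemeasurable hν] with ω hω _
      lia
    · exact ae_of_all _ fun ω h' => absurd h' hi
  have hR := h.comp hm
  have hsub (p : unitInterval) :
      ((geometricMeasure p).map (fun k => k + 1)).map (fun k => k - 1) = geometricMeasure p := by
    rw [Measure.map_map hm hm1]
    exact Measure.map_id
  rw [hsub, hsub] at hR
  obtain ⟨h0, hWm, hMm, hlaw⟩ := geometric_nonColliding hp hpq hq hR
  have hsum {X : ℕ → Ω → ℕ} {ω : Ω} (hX : ∀ i, 1 ≤ i → X i ω = (X i ω - 1) + 1) (n : ℕ) :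
      ∑ i ∈ Finset.Icc 1 n, X i ω = ∑ i ∈ Finset.Icc 1 n, (X i ω - 1) + n := by
    rw [Finset.sum_congr rfl fun i hi => hX i (Finset.mem_Icc.1 hi).1, Finset.sum_add_distrib]
    simp
  have hae := (hpos h.law_left).and (hpos h.law_right)
  have hset : neverCollide a s 1 =ᵐ[P]
      neverCollide (fun i ω => a i ω - 1) (fun i ω => s i ω - 1) 0 := by
    filter_upwards [hae] with ω hω
    refine propext (forall_congr' fun k => ?_)
    rw [hsum hω.1, hsum hω.2]
    lia
  have hcond : cond P (neverCollide a s 1) =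
      cond P (neverCollide (fun i ω => a i ω - 1) (fun i ω => s i ω - 1) 0) := by
    rw [ProbabilityTheory.cond, ProbabilityTheory.cond, measure_congr hset,
      Measure.restrict_congr_set hset]
  -- The same deterministic shift relates both processes to their versions built from $a_i-1$ and
  -- $s_i-1$; this is why the statement adds $1$ to one coordinate on each side.
  let G : (ℕ+ → ℕ × ℕ) → (ℕ+ → ℕ × ℕ) := fun u n => ((u n).1 + (n + 1), (u n).2 + n)
  have hG : Measurable G := by
    unfold G
    fun_prop
  have hW : (fun ω (n : ℕ+) => ((walkPair (fun i => a i ω) (fun i => s i ω) n).1 + 1,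
        (walkPair (fun i => a i ω) (fun i => s i ω) n).2)) =ᵐ[P]
      G ∘ fun ω => walkPair (fun i => a i ω - 1) (fun i => s i ω - 1) := by
    filter_upwards [hae] with ω hω
    funext n
    simp only [walkPair, G, Function.comp_apply]
    rw [hsum hω.1, hsum hω.2]
    rfl
  have hM : (fun ω (n : ℕ+) => (maxPath (fun i => a i ω) (fun i => s i ω) n,
        minPath (fun i => a i ω) (fun i => s i ω) n + 1)) =ᵐ[P]
      G ∘ fun ω (n : ℕ+) => (maxPath (fun i => a i ω - 1) (fun i => s i ω - 1) n,
        minPath (fun i => a i ω - 1) (fun i => s i ω - 1) n) := by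
    filter_upwards [hae] with ω hω
    funext n
    simp only [G, Function.comp_apply]
    rw [← maxPath_add_one_add_one, ← minPath_add_one_add_one]
    have e1 (j k : ℕ) (hj : 1 ≤ j) : ∑ i ∈ Finset.Icc j k, a i ω =
        ∑ i ∈ Finset.Icc j k, (a i ω - 1 + 1) :=
      Finset.sum_congr rfl fun i hi => hω.1 i (hj.trans (Finset.mem_Icc.1 hi).1)
    have e2 (j k : ℕ) (hj : 1 ≤ j) : ∑ i ∈ Finset.Icc j k, s i ω =
        ∑ i ∈ Finset.Icc j k, (s i ω - 1 + 1) :=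
      Finset.sum_congr rfl fun i hi => hω.2 i (hj.trans (Finset.mem_Icc.1 hi).1)
    -- With `g := id` these act as congruence lemmas: only the sums, whose indices are at least $1$,
    -- have to agree.
    refine Prod.ext (map_maxPath (g := id) (fun _ _ => rfl) fun j _ => ?_)
      (congrArg (· + 1) (map_minPath (g := id) (fun _ _ => rfl) fun j _ => ?_))
    · rw [id, e1 _ _ le_rfl, e2 _ _ (by lia)]
    · rw [id, e2 _ _ (by lia), e1 _ _ (by lia)]
  refine ⟨by rwa [measure_congr hset], ?_⟩
  rw [hcond, Measure.map_congr (cond_absolutelyContinuous.ae_eq hW), Measure.map_congr hM,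
    ← AEMeasurable.map_map_of_aemeasurable hG.aemeasurable hMm,
    ← AEMeasurable.map_map_of_aemeasurable hG.aemeasurable
      (hWm.mono_ac cond_absolutelyContinuous), hlaw]

end Geometric

theorem proposition1 {Ω : Type*} [MeasurableSpace Ω] (P : Measure Ω) [IsProbabilityMeasure P] :
    -- Exponential case: the event is null, and is approached through a head start `ε ↓ 0`.
    (∀ (lam mu : ℝ) (a s : ℕ → Ω → ℝ), 0 < lam → lam < mu →
      IsIIDPair a s (expMeasure lam) (expMeasure mu) P →
      (∀ ε : ℝ, 0 < ε → P (neverCollide a s ε) ≠ 0) ∧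
      ∀ f : (ℕ+ → ℝ × ℝ) →ᵇ ℝ,
        Tendsto
          (fun ε : ℝ =>
            ∫ ω, f (walkPair (fun i => a i ω) (fun i => s i ω))
              ∂(ProbabilityTheory.cond P (neverCollide a s ε)))
          (𝓝[>] 0)
          (𝓝 (∫ ω, f (fun n =>
            (maxPath (fun i => a i ω) (fun i => s i ω) n,
              minPath (fun i => a i ω) (fun i => s i ω) n)) ∂P))) ∧
    -- Geometric case, on `{0, 1, 2, …}`: genuine conditioning.
    (∀ (p q : unitInterval) (a s : ℕ → Ω → ℕ), 0 < p → p < q → q < 1 →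
      IsIIDPair a s (geometricMeasure p) (geometricMeasure q) P →
      P (neverCollide a s 0) ≠ 0 ∧
      (ProbabilityTheory.cond P (neverCollide a s 0)).map
          (fun ω => walkPair (fun i => a i ω) (fun i => s i ω)) =
        P.map (fun ω (n : ℕ+) =>
          (maxPath (fun i => a i ω) (fun i => s i ω) n,
            minPath (fun i => a i ω) (fun i => s i ω) n))) ∧
    -- Geometric case, on `{1, 2, 3, …}`: the head start is the minimal value `1` of `s_1`.
    (∀ (p q : unitInterval) (a s : ℕ → Ω → ℕ), 0 < p → p < q → q < 1 →
      IsIIDPair a s ((geometricMeasure p).map (fun k => k + 1))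
        ((geometricMeasure q).map (fun k => k + 1)) P →
      P (neverCollide a s 1) ≠ 0 ∧
      (ProbabilityTheory.cond P (neverCollide a s 1)).map
          (fun ω (n : ℕ+) =>
            ((walkPair (fun i => a i ω) (fun i => s i ω) n).1 + 1,
              (walkPair (fun i => a i ω) (fun i => s i ω) n).2)) =
        P.map (fun ω (n : ℕ+) =>
          (maxPath (fun i => a i ω) (fun i => s i ω) n,
            minPath (fun i => a i ω) (fun i => s i ω) n + 1))) := by
  refine ⟨fun lam mu a s hlam hmu h => ?_,
    fun p q a s hp hpq hq h => ?_,
    fun p q a s hp hpq hq h => geometric_succ_nonColliding hp hpq hq h⟩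
  · have hQ := isStationaryQueue_expMeasure hlam hmu
    have hpos (ε : ℝ) (hε : 0 < ε) : expMeasure (mu - lam) (Set.Iic ε) ≠ 0 :=
      expMeasure_Iic_ne_zero (sub_pos.2 hmu) hε
    refine ⟨fun ε hε => ?_, hQ.tendsto_integral_cond h hpos⟩
    rw [hQ.measure_neverCollide h]
    exact hpos ε hε
  · obtain ⟨h0, -, -, hlaw⟩ := geometric_nonColliding hp hpq hq h
    exact ⟨h0, hlaw⟩
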